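/- Let $\mathbb D$ be the open unit disk, $\overline{\mathbb D}$ its closure, and $\overline{\mathbb D}(c,\rho)=\{\zeta\in\mathbb C:|\zeta-c|\le\rho\}$. Let $\mathcal H_0$ be the class of analytic maps $f:\mathbb D\to\mathbb D$ with $f(0)=0$. Put $T_a(z)=\dfrac{z+a}{1+\overline a z}$. Let $z_0,w_0\in\mathbb D$ with $s=|w_0|<r=|z_0|$, and let $\lambda,\mu,\tau\in\overline{\mathbb D}$. Define $$c_1=\frac{w_0}{z_0},\qquad \rho_1=\frac{r^2-s^2}{r(1-r^2)},$$ $$c_2=\frac{2(r^2-s^2)}{z_0^2(1-r^2)^2}\lambda(1-\overline{w_0}\lambda),\qquad \rho_2=\frac{2(r^2-s^2)}{r(1-r^2)^2}(1-|\lambda|^2),$$ $$c_3=\frac{6(r^2-s^2)}{z_0^3(1-r^2)^3}\bigl(\mathcal A+z_0\mu(1-|\lambda|^2)(1+r^2-2\overline{w_0}\lambda-z_0\overline\lambda\mu)\bigr),\qquad \rho_3=\frac{6(r^2-s^2)}{r(1-r^2)^3}(1-|\lambda|^2)(1-|\mu|^2),$$ $$c_4=\frac{24(r^2-s^2)}{z_0^4(1-r^2)^4}\bigl[\mathcal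 B+z_0^2\tau(1-|\lambda|^2)(1-|\mu|^2)(1+2r^2-2\overline{w_0}\lambda-2z_0\overline\lambda\mu-z_0\overline\mu\tau)\bigr],$$ $$\rho_4=\frac{24(r^2-s^2)}{r(1-r^2)^4}(1-|\lambda|^2)(1-|\mu|^2)(1-|\tau|^2),$$ where $\mathcal A=\overline{w_0}^2\lambda^3-\overline{w_0}(1+r^2)\lambda^2+r^2\lambda$ and, with $X=-\overline{w_0}\lambda^2+r^2\lambda+z_0\mu(1-|\lambda|^2)$, $$\begin{aligned}\mathcal B={}&\lambda r^6-\overline{w_0}^3\lambda^4-3\overline{w_0}^2\lambda^2X\\&+(1-r^2-2\overline{w_0}\lambda)\bigl(\lambda(\overline{w_0}\lambda-r^2)^2+z_0\mu(1-|\lambda|^2)(2r^2-2\overline{w_0}\lambda-z_0\overline\lambda\mu)\bigr)\\&-\overline{w_0}X^2+z_0^3(1-|\lambda|^2)(\overline\lambda^2\mu^3+3\overline{z_0}^2\mu-3\overline{z_0}\overline\lambda\mu^2).\end{aligned}$$ Set $u_0=w_0/z_0$, $\lambda_0=r^2\lambda/z_0^2$, $\mu_0=r^2\mu/z_0^2$,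 $\tau_0=r^2\tau/z_0^2$, and let $\mathcal F$ be the set of all $f\in\mathcal H_0$ such that $$f(z_0)=w_0,\quad f'(z_0)=c_1+\rho_1\frac{r\lambda}{z_0},\quad f''(z_0)=c_2+\rho_2\frac{r\mu}{z_0},\quad f'''(z_0)=c_3+\rho_3\frac{r\tau}{z_0}.$$ 1. If $|\lambda|=1$, then every $f\in\mathcal F$ satisfies $f^{(4)}(z_0)=c_4$ and $f(z)=zT_{u_0}(\lambda_0T_{-z_0}(z))$ on $\mathbb D$. 2. If $|\lambda|<1$ and $|\mu|=1$, then every $f\in\mathcal F$ satisfies $f^{(4)}(z_0)=c_4$ and $f(z)=zT_{u_0}\bigl(T_{-z_0}(z)T_{\lambda_0}(\mu_0T_{-z_0}(z))\bigr)$ on $\mathbb D$. 3. If $|\lambda|<1$, $|\mu|<1$ and $|\tau|=1$, then every $f\in\mathcal F$ satisfies $f^{(4)}(z_0)=c_4$ and $f(z)=zT_{u_0}\bigl(T_{-z_0}(z)T_{\lambda_0}(T_{-z_0}(z)T_{\mu_0}(\tau_0T_{-z_0}(z)))\bigr)$ on $\mathbb D$. 4. If $|\lambda|<1$, $|\mu|<1$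 and $|\tau|<1$, put $f_\alpha(z)=zT_{u_0}\bigl(T_{-z_0}(z)T_{\lambda_0}(T_{-z_0}(z)T_{\mu_0}(T_{-z_0}(z)T_{\tau_0}(\alpha T_{-z_0}(z))))\bigr)$ for $\alpha\in\overline{\mathbb D}$. Then $f_\alpha\in\mathcal F$ for every $\alpha\in\overline{\mathbb D}$, and $$\{f^{(4)}(z_0):f\in\mathcal F\}=\overline{\mathbb D}(c_4,\rho_4)=\{f_\alpha^{(4)}(z_0):\alpha\in\overline{\mathbb D}\}.$$ Furthermore, for $f\in\mathcal F$, $f^{(4)}(z_0)\in\partial\mathbb D(c_4,\rho_4)$ if and only if $f=f_{e^{i\theta}}$ on $\mathbb D$ for some $\theta\in\mathbb R$. -/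

import Mathlib

open Metric Set
open scoped ComplexConjugate

noncomputable section

namespace Dieudonne

/-- The class of analytic self-maps `f` of the open unit disk with `f 0 = 0`.
Only the values on the open unit disk are constrained. -/
def H0 : Set (ℂ → ℂ) :=
  {f | DifferentiableOn ℂ f (ball 0 1) ∧ MapsTo f (ball 0 1) (ball 0 1) ∧ f 0 = 0}

/-- The disk automorphism `T_a (z) = (z + a) / (1 + conj a * z)` (used for `‖a‖ < 1`, `‖z‖ < 1`). -/
def T (a z : ℂ) : ℂ := (z + a) / (1 + conj a * z)

/-- Center of the disk for the first derivative. -/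
def c₁ (z₀ w₀ : ℂ) : ℂ := w₀ / z₀

/-- Radius of the disk for the first derivative. -/
def ρ₁ (z₀ w₀ : ℂ) : ℝ := (‖z₀‖ ^ 2 - ‖w₀‖ ^ 2) / (‖z₀‖ * (1 - ‖z₀‖ ^ 2))

/-- Center of the disk for the second derivative. -/
def c₂ (z₀ w₀ lam : ℂ) : ℂ :=
  2 * ((‖z₀‖ : ℂ) ^ 2 - (‖w₀‖ : ℂ) ^ 2) / (z₀ ^ 2 * (1 - (‖z₀‖ : ℂ) ^ 2) ^ 2) *
    (lam * (1 - conj w₀ * lam))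

/-- Radius of the disk for the second derivative. -/
def ρ₂ (z₀ w₀ lam : ℂ) : ℝ :=
  2 * (‖z₀‖ ^ 2 - ‖w₀‖ ^ 2) / (‖z₀‖ * (1 - ‖z₀‖ ^ 2) ^ 2) * (1 - ‖lam‖ ^ 2)

/-- The part of the bracket in `c₃` that depends only on `z₀, w₀, lam`. -/
def coeffA (z₀ w₀ lam : ℂ) : ℂ :=
  conj w₀ ^ 2 * lam ^ 3 - conj w₀ * (1 + (‖z₀‖ : ℂ) ^ 2) * lam ^ 2 + (‖z₀‖ : ℂ) ^ 2 * lam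

/-- Center of the disk for the third derivative. -/
def c₃ (z₀ w₀ lam mu : ℂ) : ℂ :=
  6 * ((‖z₀‖ : ℂ) ^ 2 - (‖w₀‖ : ℂ) ^ 2) / (z₀ ^ 3 * (1 - (‖z₀‖ : ℂ) ^ 2) ^ 3) *
    (coeffA z₀ w₀ lam +
      z₀ * mu * (1 - (‖lam‖ : ℂ) ^ 2) *
        (1 + (‖z₀‖ : ℂ) ^ 2 - 2 * conj w₀ * lam - z₀ * conj lam * mu))

/-- Radius of the disk for the third derivative. -/
def ρ₃ (z₀ w₀ lam mu : ℂ) : ℝ :=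
  6 * (‖z₀‖ ^ 2 - ‖w₀‖ ^ 2) / (‖z₀‖ * (1 - ‖z₀‖ ^ 2) ^ 3) *
    ((1 - ‖lam‖ ^ 2) * (1 - ‖mu‖ ^ 2))

/-- The part of the bracket in `c₄` that does not depend on `tau`. -/
def coeffB (z₀ w₀ lam mu : ℂ) : ℂ :=
  lam * (‖z₀‖ : ℂ) ^ 6 - conj w₀ ^ 3 * lam ^ 4
    - 3 * conj w₀ ^ 2 * lam ^ 2 *
      (-(conj w₀ * lam ^ 2) + (‖z₀‖ : ℂ) ^ 2 * lam + z₀ * mu * (1 - (‖lam‖ : ℂ) ^ 2))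
    + (1 - (‖z₀‖ : ℂ) ^ 2 - 2 * conj w₀ * lam) *
      (lam * (conj w₀ * lam - (‖z₀‖ : ℂ) ^ 2) ^ 2 +
        z₀ * mu * (1 - (‖lam‖ : ℂ) ^ 2) *
          (2 * (‖z₀‖ : ℂ) ^ 2 - 2 * conj w₀ * lam - z₀ * conj lam * mu))
    - conj w₀ *
      (-(conj w₀ * lam ^ 2) + (‖z₀‖ : ℂ) ^ 2 * lam + z₀ * mu * (1 - (‖lam‖ : ℂ) ^ 2)) ^ 2
    + z₀ ^ 3 * (1 - (‖lam‖ : ℂ) ^ 2) *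
      (conj lam ^ 2 * mu ^ 3 + 3 * conj z₀ ^ 2 * mu - 3 * conj z₀ * conj lam * mu ^ 2)

/-- Center of the disk for the fourth derivative. -/
def c₄ (z₀ w₀ lam mu tau : ℂ) : ℂ :=
  24 * ((‖z₀‖ : ℂ) ^ 2 - (‖w₀‖ : ℂ) ^ 2) / (z₀ ^ 4 * (1 - (‖z₀‖ : ℂ) ^ 2) ^ 4) *
    (coeffB z₀ w₀ lam mu +
      z₀ ^ 2 * tau * (1 - (‖lam‖ : ℂ) ^ 2) * (1 - (‖mu‖ : ℂ) ^ 2) *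
        (1 + 2 * (‖z₀‖ : ℂ) ^ 2 - 2 * conj w₀ * lam - 2 * z₀ * conj lam * mu
          - z₀ * conj mu * tau))

/-- Radius of the disk for the fourth derivative. -/
def ρ₄ (z₀ w₀ lam mu tau : ℂ) : ℝ :=
  24 * (‖z₀‖ ^ 2 - ‖w₀‖ ^ 2) / (‖z₀‖ * (1 - ‖z₀‖ ^ 2) ^ 4) *
    ((1 - ‖lam‖ ^ 2) * (1 - ‖mu‖ ^ 2) * (1 - ‖tau‖ ^ 2))

/-- The prescribed value `w₁` of the first derivative. -/
def w₁ (z₀ w₀ lam : ℂ) : ℂ := c₁ z₀ w₀ + (ρ₁ z₀ w₀ : ℂ) * ((‖z₀‖ : ℂ) * lam / z₀)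

/-- The prescribed value `w₂` of the second derivative. -/
def w₂ (z₀ w₀ lam mu : ℂ) : ℂ :=
  c₂ z₀ w₀ lam + (ρ₂ z₀ w₀ lam : ℂ) * ((‖z₀‖ : ℂ) * mu / z₀)

/-- The prescribed value `w₃` of the third derivative. -/
def w₃ (z₀ w₀ lam mu tau : ℂ) : ℂ :=
  c₃ z₀ w₀ lam mu + (ρ₃ z₀ w₀ lam mu : ℂ) * ((‖z₀‖ : ℂ) * tau / z₀)

/-- The functions in `H0` with `f z₀ = w₀` and first three derivatives `w₁, w₂, w₃` at `z₀`. -/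
def Class (z₀ w₀ lam mu tau : ℂ) : Set (ℂ → ℂ) :=
  {f | f ∈ H0 ∧ f z₀ = w₀ ∧ deriv f z₀ = w₁ z₀ w₀ lam ∧
    iteratedDeriv 2 f z₀ = w₂ z₀ w₀ lam mu ∧ iteratedDeriv 3 f z₀ = w₃ z₀ w₀ lam mu tau}

/-- The rescaled parameter `r² x / z₀²`, where `r = ‖z₀‖`: it gives `λ₀, μ₀, τ₀` from `λ, μ, τ`. -/
def rot (z₀ x : ℂ) : ℂ := (‖z₀‖ : ℂ) ^ 2 * x / z₀ ^ 2

/-- `z T_{u₀}(λ₀ T_{-z₀}(z))`, where `u₀ = w₀ / z₀`. -/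
def F₁ (z₀ w₀ lam z : ℂ) : ℂ := z * T (w₀ / z₀) (rot z₀ lam * T (-z₀) z)

/-- `z T_{u₀}(T_{-z₀}(z) T_{λ₀}(μ₀ T_{-z₀}(z)))`. -/
def F₂ (z₀ w₀ lam mu z : ℂ) : ℂ :=
  z * T (w₀ / z₀) (T (-z₀) z * T (rot z₀ lam) (rot z₀ mu * T (-z₀) z))

/-- `z T_{u₀}(T_{-z₀}(z) T_{λ₀}(T_{-z₀}(z) T_{μ₀}(τ₀ T_{-z₀}(z))))`. -/
def F₃ (z₀ w₀ lam mu tau z : ℂ) : ℂ :=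
  z * T (w₀ / z₀) (T (-z₀) z * T (rot z₀ lam) (T (-z₀) z * T (rot z₀ mu)
    (rot z₀ tau * T (-z₀) z)))

/-- `z T_{u₀}(T_{-z₀}(z) T_{λ₀}(T_{-z₀}(z) T_{μ₀}(T_{-z₀}(z) T_{τ₀}(α T_{-z₀}(z)))))`. -/
def F₄ (z₀ w₀ lam mu tau α z : ℂ) : ℂ :=
  z * T (w₀ / z₀) (T (-z₀) z * T (rot z₀ lam) (T (-z₀) z * T (rot z₀ mu)
    (T (-z₀) z * T (rot z₀ tau) (α * T (-z₀) z))))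

end Dieudonne

end

/-! Write `f z = z * g z`; by the Schwarz lemma `g` maps the disk to the closed disk. Run the Schur
algorithm on `g` at the base point `z₀` instead of `0`: while `‖g z₀‖ < 1`, one has `g = T_a
(T_{-z₀} k)` with `a = g z₀` and `k` again a Schur function. The iterates `g₁, g₂, ...` encode the
jet of `f` at `z₀`: given the earlier parameters, the `j`-th derivative is an affine function of
`g_j z₀`, and its center and radius are `c_j` and `ρ_j`. Hence, as long as the radii are positive,
the prescribed derivatives force `g₁ z₀, g₂ z₀, g₃ z₀` to be the rotated `lam, mu, tau`. The fourth
derivative is then affine in `g₄ z₀`, which ranges over the whole closed disk. A unimodular value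
makes an iterate constant by the maximum principle, which gives the rigidity statements.

The affine formulas come from comparing Taylor coefficients in a denominator-free form of the step
(`SchurStep.taylor_eq`, `iteratedDeriv_of_schurStep`). That form still holds after the algorithm
stops, so one chain (`exists_isSchurChain`) and one formula for the fourth derivative
(`iteratedDeriv_eq_w₄`) serve all four cases. -/

namespace Dieudonne

/-! ### Disk automorphisms and one step of the Schur algorithm -/

/-- The Schur class: analytic maps from the open unit disk to the closed unit disk. -/
def Schur (g : ℂ → ℂ) : Prop :=
  DifferentiableOn ℂ g (ball 0 1) ∧ ∀ z ∈ ball (0 : ℂ) 1, ‖g z‖ ≤ 1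

/-- The relation `g = T_a (T_{-z₀} h)` on the unit disk, with denominators cleared. -/
def SchurStep (z₀ a : ℂ) (h g : ℂ → ℂ) : Prop :=
  ∀ z ∈ ball (0 : ℂ) 1,
    (1 - conj z₀ * z + conj a * ((z - z₀) * h z)) * g z =
      (z - z₀) * h z + a * (1 - conj z₀ * z)

theorem one_add_conj_mul_ne_zero {a z : ℂ} (ha : ‖a‖ < 1) (hz : ‖z‖ ≤ 1) :
    1 + conj a * z ≠ 0 := by
  intro h
  have h1 : ‖conj a * z‖ < 1 := by
    rw [norm_mul, RCLike.norm_conj]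
    nlinarith [norm_nonneg a, norm_nonneg z]
  rw [eq_neg_of_add_eq_zero_right h, norm_neg, norm_one] at h1
  exact lt_irrefl _ h1

theorem one_sub_conj_mul_ne_zero {a z : ℂ} (ha : ‖a‖ < 1) (hz : ‖z‖ ≤ 1) :
    1 - conj a * z ≠ 0 := by
  simpa [sub_eq_add_neg] using one_add_conj_mul_ne_zero (a := -a) (z := z) (by simpa using ha) hz

theorem normSq_one_add_sub_normSq_add (a z : ℂ) :
    ‖1 + conj a * z‖ ^ 2 - ‖z + a‖ ^ 2 = (1 - ‖a‖ ^ 2) * (1 - ‖z‖ ^ 2) := by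
  simp only [← Complex.normSq_eq_norm_sq, Complex.normSq_apply, Complex.add_re, Complex.add_im,
    Complex.mul_re, Complex.mul_im, Complex.conj_re, Complex.conj_im, Complex.one_re,
    Complex.one_im]
  ring

theorem norm_T_lt_one {a z : ℂ} (ha : ‖a‖ < 1) (hz : ‖z‖ < 1) : ‖T a z‖ < 1 := by
  have h0 := one_add_conj_mul_ne_zero ha hz.le
  rw [T, norm_div, div_lt_one (norm_pos_iff.2 h0)]
  have h := normSq_one_add_sub_normSq_add a z
  have h1 : 0 < (1 - ‖a‖ ^ 2) * (1 - ‖z‖ ^ 2) :=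
    mul_pos (by nlinarith [norm_nonneg a]) (by nlinarith [norm_nonneg z])
  exact lt_of_pow_lt_pow_left₀ 2 (norm_nonneg _) (by linarith)

theorem T_neg_mul {a z : ℂ} (ha : ‖a‖ < 1) (hz : ‖z‖ < 1) :
    T (-a) z * (1 - conj a * z) = z - a := by
  simp only [T, map_neg, neg_mul, ← sub_eq_add_neg]
  exact div_mul_cancel₀ _ (one_sub_conj_mul_ne_zero ha hz.le)

theorem T_self_neg {a z : ℂ} (ha : ‖a‖ < 1) (hz : ‖z‖ < 1) : T a (T (-a) z) = z := by
  have h1 := T_neg_mul ha hz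
  have h2 := one_add_conj_mul_ne_zero ha (norm_T_lt_one (a := -a) (by simpa using ha) hz).le
  generalize T (-a) z = w at h1 h2
  rw [T, div_eq_iff h2]
  linear_combination h1

theorem differentiableOn_T {a : ℂ} (ha : ‖a‖ < 1) {g : ℂ → ℂ} {s : Set ℂ}
    (hg : DifferentiableOn ℂ g s) (hs : ∀ z ∈ s, ‖g z‖ ≤ 1) :
    DifferentiableOn ℂ (fun z => T a (g z)) s :=
  (hg.add_const a).div ((hg.const_mul _).const_add 1)
    fun z hz => one_add_conj_mul_ne_zero ha (hs z hz)

theorem Schur.eqOn_of_norm_eq_one {g : ℂ → ℂ} (hg : Schur g) {z₁ : ℂ} (hz₁ : z₁ ∈ ball (0 : ℂ) 1)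
    (h : ‖g z₁‖ = 1) : ∀ z ∈ ball (0 : ℂ) 1, g z = g z₁ := by
  intro z hz
  exact Complex.eqOn_of_isPreconnected_of_isMaxOn_norm (convex_ball 0 1).isPreconnected isOpen_ball
    hg.1 hz₁ (fun y hy => by simpa [h] using hg.2 y hy) hz

theorem Schur.norm_lt_one {g : ℂ → ℂ} (hg : Schur g) {z₁ : ℂ} (hz₁ : z₁ ∈ ball (0 : ℂ) 1)
    (h : ‖g z₁‖ < 1) {z : ℂ} (hz : z ∈ ball (0 : ℂ) 1) : ‖g z‖ < 1 := by
  refine lt_of_le_of_ne (hg.2 z hz) fun h1 => ?_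
  rw [hg.eqOn_of_norm_eq_one hz h1 z₁ hz₁] at h
  exact h.ne h1

theorem schur_const {a : ℂ} (ha : ‖a‖ ≤ 1) : Schur fun _ => a :=
  ⟨differentiableOn_const a, fun _ _ => ha⟩

/-- This is the Schwarz lemma; `dslope` supplies `q z / z` with its removable singularity filled in.
-/
theorem schur_dslope {q : ℂ → ℂ} (hd : DifferentiableOn ℂ q (ball 0 1))
    (hq : ∀ z ∈ ball (0 : ℂ) 1, ‖q z‖ ≤ 1) (h0 : q 0 = 0) :
    Schur (dslope q 0) ∧ ∀ z, q z = z * dslope q 0 z := by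
  refine ⟨⟨(Complex.differentiableOn_dslope (ball_mem_nhds 0 one_pos)).2 hd, fun z hz => ?_⟩,
    fun z => ?_⟩
  · have := Complex.norm_dslope_le_div_of_mapsTo_ball (R₂ := 1) hd
      (fun y hy => by simpa [h0] using hq y hy) hz
    simpa using this
  · simpa [h0] using (sub_smul_dslope q 0 z).symm

/-- Conjugating by automorphisms, `T_{-g z₀} ∘ g ∘ T_{z₀}` fixes the origin, so the Schwarz lemma
allows division by the variable. Substituting `T_{-z₀} z` back gives `k`. -/
theorem Schur.exists_step {z₀ : ℂ} (hz₀ : ‖z₀‖ < 1) {g : ℂ → ℂ} (hg : Schur g)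
    (h : ‖g z₀‖ < 1) : ∃ k, Schur k ∧ SchurStep z₀ (g z₀) k g := by
  have hz₀' : z₀ ∈ ball (0 : ℂ) 1 := by simpa using hz₀
  have hlt : ∀ z ∈ ball (0 : ℂ) 1, ‖g z‖ < 1 := fun z hz => hg.norm_lt_one hz₀' h hz
  have hT : ∀ {a z : ℂ}, ‖a‖ < 1 → z ∈ ball (0 : ℂ) 1 → T a z ∈ ball (0 : ℂ) 1 := by
    intro a z ha hz
    simpa using norm_T_lt_one ha (by simpa using hz)
  have hTd : ∀ {a : ℂ}, ‖a‖ < 1 → DifferentiableOn ℂ (T a) (ball 0 1) := fun ha =>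
    differentiableOn_T ha differentiableOn_id fun z hz => by simpa using (mem_ball_zero_iff.1 hz).le
  have hneg : ‖-g z₀‖ < 1 := by simpa using h
  have hneg' : ‖-z₀‖ < 1 := by simpa using hz₀
  have hkd : DifferentiableOn ℂ (fun z => T (-g z₀) (g z)) (ball 0 1) :=
    differentiableOn_T hneg hg.1 hg.2
  obtain ⟨hs, hq⟩ := schur_dslope (q := fun z => T (-g z₀) (g (T z₀ z)))
    (hkd.comp (hTd hz₀) fun z hz => hT hz₀ hz)
    (fun z hz => (norm_T_lt_one hneg (hlt _ (hT hz₀ hz))).le) (by simp [T])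
  refine ⟨fun z => dslope (fun z => T (-g z₀) (g (T z₀ z))) 0 (T (-z₀) z),
    ⟨hs.1.comp (hTd hneg') fun z hz => hT hneg' hz, fun z hz => hs.2 _ (hT hneg' hz)⟩, ?_⟩
  intro z hz
  have hzn : ‖z‖ < 1 := by simpa using hz
  have e := hq (T (-z₀) z)
  simp only [T_self_neg hz₀ hzn] at e
  beta_reduce
  generalize dslope (fun z => T (-g z₀) (g (T z₀ z))) 0 (T (-z₀) z) = y at e ⊢
  have h1 := one_sub_conj_mul_ne_zero h (hg.2 z hz)
  have h2 := one_sub_conj_mul_ne_zero hz₀ hzn.le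
  simp only [T, map_neg, neg_mul, ← sub_eq_add_neg] at e
  rw [div_mul_eq_mul_div, div_eq_div_iff h1 h2] at e
  linear_combination e

/-- For a unimodular constant, `conj a * a = 1` makes the cleared relation an identity in `k`. The
quotient form could degenerate to `0 / 0` here, which is why denominators are cleared. -/
theorem schurStep_of_norm_eq_one {z₀ a : ℂ} (ha : ‖a‖ = 1) {g : ℂ → ℂ}
    (hg : ∀ z ∈ ball (0 : ℂ) 1, g z = a) (k : ℂ → ℂ) : SchurStep z₀ a k g := by
  intro z hz
  have : conj a * a = 1 := by rw [Complex.conj_mul', ha]; simp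
  rw [hg z hz]
  linear_combination (z - z₀) * k z * this

theorem SchurStep.eq_T {z₀ a : ℂ} (hz₀ : ‖z₀‖ < 1) (ha : ‖a‖ < 1) {k g : ℂ → ℂ}
    (hk : Schur k) (h : SchurStep z₀ a k g) {z : ℂ} (hz : z ∈ ball (0 : ℂ) 1) :
    g z = T a (T (-z₀) z * k z) := by
  have hzn : ‖z‖ < 1 := by simpa using hz
  have h2 := one_sub_conj_mul_ne_zero hz₀ hzn.le
  have h3 : ‖T (-z₀) z * k z‖ ≤ 1 := by
    rw [norm_mul]
    exact mul_le_one₀ (norm_T_lt_one (by simpa using hz₀) hzn).le (norm_nonneg _) (hk.2 z hz)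
  have h4 := one_add_conj_mul_ne_zero ha h3
  rw [T, eq_div_iff h4]
  have e := h z hz
  have hx := T_neg_mul hz₀ hzn
  refine mul_right_cancel₀ h2 ?_
  linear_combination e + (g z * conj a * k z - k z) * hx

theorem schurStep_T {z₀ a : ℂ} (hz₀ : ‖z₀‖ < 1) (ha : ‖a‖ < 1) {k : ℂ → ℂ} (hk : Schur k) :
    Schur (fun z => T a (T (-z₀) z * k z)) ∧
      SchurStep z₀ a k (fun z => T a (T (-z₀) z * k z)) := by
  have hneg : ‖-z₀‖ < 1 := by simpa using hz₀
  have h3 : ∀ z ∈ ball (0 : ℂ) 1, ‖T (-z₀) z * k z‖ < 1 := by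
    intro z hz
    have hzn : ‖z‖ < 1 := by simpa using hz
    rw [norm_mul]
    exact mul_lt_one_of_nonneg_of_lt_one_left (norm_nonneg _) (norm_T_lt_one hneg hzn) (hk.2 z hz)
  refine ⟨⟨differentiableOn_T ha ((differentiableOn_T hneg differentiableOn_id fun z hz => ?_).mul
    hk.1) fun z hz => (h3 z hz).le, fun z hz => (norm_T_lt_one ha (h3 z hz)).le⟩, ?_⟩
  · simpa using (mem_ball_zero_iff.1 hz).le
  intro z hz
  have hzn : ‖z‖ < 1 := by simpa using hz
  have h4 := one_add_conj_mul_ne_zero ha (h3 z hz).le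
  have e : T a (T (-z₀) z * k z) * (1 + conj a * (T (-z₀) z * k z)) = T (-z₀) z * k z + a :=
    div_mul_cancel₀ _ h4
  beta_reduce
  generalize T a (T (-z₀) z * k z) = y at e ⊢
  have hx := T_neg_mul hz₀ hzn
  linear_combination (1 - conj z₀ * z) * e - (y * conj a * k z - k z) * hx

/-! ### Taylor series at the base point and the coefficient recursion -/

/-- The Taylor series of `f` at `z₀`. -/
noncomputable def taylor (z₀ : ℂ) (f : ℂ → ℂ) : PowerSeries ℂ :=
  PowerSeries.mk fun n => iteratedDeriv n f z₀ / n.factorial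

theorem taylor_congr {z₀ : ℂ} {f g : ℂ → ℂ} (h : f =ᶠ[nhds z₀] g) : taylor z₀ f = taylor z₀ g := by
  ext n
  simp [taylor, h.iteratedDeriv_eq n]

theorem taylor_add {z₀ : ℂ} {f g : ℂ → ℂ} (hf : AnalyticAt ℂ f z₀) (hg : AnalyticAt ℂ g z₀) :
    taylor z₀ (fun z => f z + g z) = taylor z₀ f + taylor z₀ g := by
  ext n
  simp [taylor, iteratedDeriv_fun_add hf.contDiffAt hg.contDiffAt, add_div]

theorem taylor_mul {z₀ : ℂ} {f g : ℂ → ℂ} (hf : AnalyticAt ℂ f z₀) (hg : AnalyticAt ℂ g z₀) :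
    taylor z₀ (fun z => f z * g z) = taylor z₀ f * taylor z₀ g := by
  ext n
  simp only [taylor, PowerSeries.coeff_mul, PowerSeries.coeff_mk,
    iteratedDeriv_fun_mul hf.contDiffAt hg.contDiffAt,
    Finset.Nat.sum_antidiagonal_eq_sum_range_succ_mk, Finset.sum_div]
  refine Finset.sum_congr rfl fun i hi => ?_
  have hi : i ≤ n := by simpa [Nat.lt_succ_iff] using hi
  have h1 : (n.factorial : ℂ) ≠ 0 := by exact_mod_cast n.factorial_ne_zero
  have h2 : (i.factorial : ℂ) ≠ 0 := by exact_mod_cast i.factorial_ne_zero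
  have h3 : ((n - i).factorial : ℂ) ≠ 0 := by exact_mod_cast (n - i).factorial_ne_zero
  rw [Nat.cast_choose ℂ hi]
  field_simp

theorem taylor_const (z₀ c : ℂ) : taylor z₀ (fun _ => c) = PowerSeries.C c := by
  ext n
  rcases n with _ | n <;> simp [taylor, iteratedDeriv_const, PowerSeries.coeff_C]

theorem taylor_id (z₀ : ℂ) : taylor z₀ (fun z => z) = PowerSeries.C z₀ + PowerSeries.X := by
  ext n
  rcases n with _ | _ | n <;>
    simp [taylor, iteratedDeriv_fun_id, PowerSeries.coeff_X]

theorem coeff_zero_taylor (z₀ : ℂ) (f : ℂ → ℂ) : PowerSeries.coeff 0 (taylor z₀ f) = f z₀ := by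
  simp [taylor]

theorem Schur.analyticAt {g : ℂ → ℂ} (hg : Schur g) {z₀ : ℂ} (hz₀ : ‖z₀‖ < 1) :
    AnalyticAt ℂ g z₀ :=
  hg.1.analyticAt (isOpen_ball.mem_nhds (by simpa using hz₀))

theorem SchurStep.taylor_eq {z₀ a : ℂ} (hz₀ : ‖z₀‖ < 1) {k g : ℂ → ℂ} (hk : Schur k)
    (hg : Schur g) (h : SchurStep z₀ a k g) :
    PowerSeries.C (1 - conj z₀ * z₀) * taylor z₀ g = PowerSeries.C (a * (1 - conj z₀ * z₀)) +
      PowerSeries.X * (taylor z₀ k - PowerSeries.C (a * conj z₀) +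
        PowerSeries.C (conj z₀) * taylor z₀ g -
        PowerSeries.C (conj a) * (taylor z₀ k * taylor z₀ g)) := by
  have hka := hk.analyticAt hz₀
  have hga := hg.analyticAt hz₀
  have e : taylor z₀ (fun z => (1 + (-conj z₀) * z + conj a * ((z + (-z₀)) * k z)) * g z) =
      taylor z₀ (fun z => (z + (-z₀)) * k z + a * (1 + (-conj z₀) * z)) := by
    refine taylor_congr ?_
    filter_upwards [isOpen_ball.mem_nhds (show z₀ ∈ ball (0 : ℂ) 1 by simpa using hz₀)] with z hz
    linear_combination h z hz
  rw [taylor_mul (by fun_prop) hga, taylor_add (by fun_prop) (by fun_prop),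
    taylor_add (by fun_prop) (by fun_prop), taylor_add (by fun_prop) (by fun_prop),
    taylor_mul (by fun_prop) (by fun_prop), taylor_mul (by fun_prop) (by fun_prop),
    taylor_mul (by fun_prop) (by fun_prop), taylor_mul (by fun_prop) (by fun_prop),
    taylor_add (by fun_prop) (by fun_prop), taylor_add (by fun_prop) (by fun_prop),
    taylor_mul (by fun_prop) (by fun_prop)] at e
  simp only [taylor_const, taylor_id, map_neg, map_mul, map_sub, map_one] at e ⊢
  linear_combination e

/-- The Taylor coefficient of `f` at `z₀`, scaled by `(1 - |z₀|²)ⁿ`. -/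
noncomputable def scaledCoeff (z₀ : ℂ) (f : ℂ → ℂ) (n : ℕ) : ℂ :=
  (1 - conj z₀ * z₀) ^ n * PowerSeries.coeff n (taylor z₀ f)

/-- The scaled Taylor coefficients, rotated so that the zeroth one inverts `rot z₀`. -/
noncomputable def rotCoeff (z₀ : ℂ) (f : ℂ → ℂ) (n : ℕ) : ℂ :=
  z₀ / conj z₀ * scaledCoeff z₀ f n

theorem scaledCoeff_zero (z₀ : ℂ) (f : ℂ → ℂ) : scaledCoeff z₀ f 0 = f z₀ := by
  simp [scaledCoeff, taylor]

theorem rot_eq {z₀ : ℂ} (h : z₀ ≠ 0) (x : ℂ) : rot z₀ x = conj z₀ / z₀ * x := by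
  rw [rot, ← Complex.conj_mul']
  field_simp

theorem rot_rotCoeff {z₀ : ℂ} (h : z₀ ≠ 0) (f : ℂ → ℂ) : rot z₀ (rotCoeff z₀ f 0) = f z₀ := by
  have hc : conj z₀ ≠ 0 := by simpa using h
  rw [rot_eq h, rotCoeff, scaledCoeff_zero]
  field_simp

theorem norm_rot {z₀ : ℂ} (h : z₀ ≠ 0) (x : ℂ) : ‖rot z₀ x‖ = ‖x‖ := by
  have : ‖z₀‖ ≠ 0 := by simpa using h
  rw [rot_eq h, norm_mul, norm_div, RCLike.norm_conj, div_self this, one_mul]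

theorem rotCoeff_zero_of_eq_rot {z₀ : ℂ} (h : z₀ ≠ 0) {f : ℂ → ℂ} {x : ℂ} (hf : f z₀ = rot z₀ x) :
    rotCoeff z₀ f 0 = x := by
  have hc : conj z₀ ≠ 0 := by simpa using h
  rw [rotCoeff, scaledCoeff_zero, hf, rot_eq h]
  field_simp

/-- Each coefficient of `g` is found from earlier ones of `k` and `g`. The factor `1 - conj a * a`
arises by joining the newest coefficient of `k` with its product with `g z₀ = a`; the scaling
absorbs every `1 - conj z₀ * z₀`. -/
theorem SchurStep.scaledCoeff_eq {z₀ a : ℂ} (hz₀ : ‖z₀‖ < 1) {k g : ℂ → ℂ} (hk : Schur k)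
    (hg : Schur g) (h : SchurStep z₀ a k g) (ha : g z₀ = a) :
    scaledCoeff z₀ g 1 = (1 - conj a * a) * scaledCoeff z₀ k 0 ∧
    scaledCoeff z₀ g 2 = (1 - conj a * a) * scaledCoeff z₀ k 1 +
      (conj z₀ - conj a * scaledCoeff z₀ k 0) * scaledCoeff z₀ g 1 ∧
    scaledCoeff z₀ g 3 = (1 - conj a * a) * scaledCoeff z₀ k 2 +
      (conj z₀ - conj a * scaledCoeff z₀ k 0) * scaledCoeff z₀ g 2 -
      conj a * scaledCoeff z₀ k 1 * scaledCoeff z₀ g 1 ∧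
    scaledCoeff z₀ g 4 = (1 - conj a * a) * scaledCoeff z₀ k 3 +
      (conj z₀ - conj a * scaledCoeff z₀ k 0) * scaledCoeff z₀ g 3 -
      conj a * scaledCoeff z₀ k 1 * scaledCoeff z₀ g 2 -
      conj a * scaledCoeff z₀ k 2 * scaledCoeff z₀ g 1 := by
  have e := h.taylor_eq hz₀ hk hg
  have h0 : PowerSeries.coeff 0 (taylor z₀ g) = a := by rw [coeff_zero_taylor, ha]
  have en := fun n => congrArg (PowerSeries.coeff (n + 1)) e
  simp only [map_add (PowerSeries.coeff _), map_sub (PowerSeries.coeff _),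
    PowerSeries.coeff_succ_X_mul, PowerSeries.coeff_C_mul] at en
  simp only [PowerSeries.coeff_C, PowerSeries.coeff_mul, Nat.add_eq_zero_iff, one_ne_zero,
    and_false, if_false, zero_add] at en
  have e1 := en 0
  have e2 := en 1
  have e3 := en 2
  have e4 := en 3
  -- The zeroth coefficient must stay in `coeff 0` form for `h0` to apply and to match
  -- `scaledCoeff`.
  simp [Finset.Nat.antidiagonal_succ, -PowerSeries.coeff_zero_eq_constantCoeff, h0] at e1 e2 e3 e4
  simp only [scaledCoeff]
  generalize 1 - conj z₀ * z₀ = D at *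
  refine ⟨?_, ?_, ?_, ?_⟩
  · linear_combination e1
  · linear_combination D * e2
  · linear_combination D ^ 2 * e3
  · linear_combination D ^ 3 * e4

/-- The recursion is unchanged by a common unimodular rotation of the parameter and the
coefficients, since `conj a` times a coefficient is invariant. -/
theorem SchurStep.rotCoeff_eq {z₀ l : ℂ} (hz₀ : ‖z₀‖ < 1) (h0 : z₀ ≠ 0) {k g : ℂ → ℂ}
    (hk : Schur k) (hg : Schur g) (h : SchurStep z₀ (rot z₀ l) k g) (hl : g z₀ = rot z₀ l) :
    rotCoeff z₀ g 1 = (1 - conj l * l) * rotCoeff z₀ k 0 ∧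
    rotCoeff z₀ g 2 = (1 - conj l * l) * rotCoeff z₀ k 1 +
      (conj z₀ - conj l * rotCoeff z₀ k 0) * rotCoeff z₀ g 1 ∧
    rotCoeff z₀ g 3 = (1 - conj l * l) * rotCoeff z₀ k 2 +
      (conj z₀ - conj l * rotCoeff z₀ k 0) * rotCoeff z₀ g 2 -
      conj l * rotCoeff z₀ k 1 * rotCoeff z₀ g 1 := by
  have hc : conj z₀ ≠ 0 := by simpa using h0
  obtain ⟨e1, e2, e3, -⟩ := h.scaledCoeff_eq hz₀ hk hg hl
  simp only [rotCoeff, e1, e2, e3, rot_eq h0, map_mul, map_div₀, Complex.conj_conj]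
  refine ⟨?_, ?_, ?_⟩ <;> (field_simp; try ring)

/-! ### Derivatives of `f` as affine functions of the last Schur parameter -/

/-- `outer₂`, `outer₃`, `outer₄` are the numerators of the scaled Taylor coefficients of
`T_{w₀/z₀} (T_{-z₀} k)` in terms of the rotated coefficients `η` of `k`. -/
noncomputable def outer₂ (z₀ w₀ : ℂ) (η : ℕ → ℂ) : ℂ :=
  z₀ * η 1 + (conj z₀ * z₀ - conj w₀ * η 0) * η 0

noncomputable def outer₃ (z₀ w₀ : ℂ) (η : ℕ → ℂ) : ℂ :=
  z₀ ^ 2 * η 2 + (conj z₀ * z₀ - conj w₀ * η 0) * outer₂ z₀ w₀ η - z₀ * conj w₀ * η 1 * η 0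

noncomputable def outer₄ (z₀ w₀ : ℂ) (η : ℕ → ℂ) : ℂ :=
  z₀ ^ 3 * η 3 + (conj z₀ * z₀ - conj w₀ * η 0) * outer₃ z₀ w₀ η -
    z₀ * conj w₀ * η 1 * outer₂ z₀ w₀ η - z₀ ^ 2 * conj w₀ * η 2 * η 0

theorem iteratedDeriv_of_schurStep {z₀ w₀ : ℂ} (hz₀ : ‖z₀‖ < 1) (h0 : z₀ ≠ 0) {f k g : ℂ → ℂ}
    (hk : Schur k) (hg : Schur g) (h : SchurStep z₀ (w₀ / z₀) k g) (hw : g z₀ = w₀ / z₀)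
    (hf : ∀ z ∈ ball (0 : ℂ) 1, f z = z * g z) :
    deriv f z₀ = w₀ / z₀ + (conj z₀ * z₀ - conj w₀ * w₀) / (z₀ * (1 - conj z₀ * z₀)) *
      rotCoeff z₀ k 0 ∧
    iteratedDeriv 2 f z₀ =
      2 * (conj z₀ * z₀ - conj w₀ * w₀) / (z₀ ^ 2 * (1 - conj z₀ * z₀) ^ 2) *
      (outer₂ z₀ w₀ (rotCoeff z₀ k) + (1 - conj z₀ * z₀) * rotCoeff z₀ k 0) ∧
    iteratedDeriv 3 f z₀ =
      6 * (conj z₀ * z₀ - conj w₀ * w₀) / (z₀ ^ 3 * (1 - conj z₀ * z₀) ^ 3) *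
      (outer₃ z₀ w₀ (rotCoeff z₀ k) + (1 - conj z₀ * z₀) * outer₂ z₀ w₀ (rotCoeff z₀ k)) ∧
    iteratedDeriv 4 f z₀ =
      24 * (conj z₀ * z₀ - conj w₀ * w₀) / (z₀ ^ 4 * (1 - conj z₀ * z₀) ^ 4) *
      (outer₄ z₀ w₀ (rotCoeff z₀ k) + (1 - conj z₀ * z₀) * outer₃ z₀ w₀ (rotCoeff z₀ k)) := by
  have hc : conj z₀ ≠ 0 := by simpa using h0
  have hD : 1 - conj z₀ * z₀ ≠ 0 := one_sub_conj_mul_ne_zero hz₀ hz₀.le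
  have e : taylor z₀ f = (PowerSeries.C z₀ + PowerSeries.X) * taylor z₀ g := by
    rw [← taylor_id, ← taylor_mul (by fun_prop) (hg.analyticAt hz₀)]
    refine taylor_congr ?_
    filter_upwards [isOpen_ball.mem_nhds (show z₀ ∈ ball (0 : ℂ) 1 by simpa using hz₀)] with z hz
    exact hf z hz
  have en : ∀ n, (1 - conj z₀ * z₀) ^ (n + 1) * PowerSeries.coeff (n + 1) (taylor z₀ f) =
      z₀ * scaledCoeff z₀ g (n + 1) + (1 - conj z₀ * z₀) * scaledCoeff z₀ g n := by
    intro n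
    simp only [e, scaledCoeff, add_mul, map_add, PowerSeries.coeff_C_mul,
      PowerSeries.coeff_succ_X_mul]
    ring
  obtain ⟨d1, d2, d3, d4⟩ := h.scaledCoeff_eq hz₀ hk hg hw
  have d0 : scaledCoeff z₀ g 0 = w₀ / z₀ := by rw [scaledCoeff_zero, hw]
  have hs : ∀ n, scaledCoeff z₀ k n = conj z₀ / z₀ * rotCoeff z₀ k n := by
    intro n
    rw [rotCoeff]
    field_simp
  have e1 := en 0
  have e2 := en 1
  have e3 := en 2
  have e4 := en 3
  simp only [hs, map_div₀] at d1 d2 d3 d4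
  generalize rotCoeff z₀ k = η at *
  have f1 : scaledCoeff z₀ g 1 = (conj z₀ * z₀ - conj w₀ * w₀) / z₀ ^ 2 * η 0 := by
    rw [d1]; field_simp
  have f2 : scaledCoeff z₀ g 2 = (conj z₀ * z₀ - conj w₀ * w₀) / z₀ ^ 3 * outer₂ z₀ w₀ η := by
    rw [d2, f1, outer₂]; field_simp
  have f3 : scaledCoeff z₀ g 3 = (conj z₀ * z₀ - conj w₀ * w₀) / z₀ ^ 4 * outer₃ z₀ w₀ η := by
    rw [d3, f1, f2, outer₃]; field_simp
  have f4 : scaledCoeff z₀ g 4 = (conj z₀ * z₀ - conj w₀ * w₀) / z₀ ^ 5 * outer₄ z₀ w₀ η := by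
    rw [d4, f1, f2, f3, outer₄]; field_simp
  simp only [zero_add, Nat.reduceAdd, d0, f1, f2, f3, f4, taylor,
    PowerSeries.coeff_mk] at e1 e2 e3 e4
  norm_num [Nat.factorial] at e1 e2 e3 e4
  generalize 1 - conj z₀ * z₀ = D at *
  refine ⟨?_, ?_, ?_, ?_⟩
  · refine mul_left_cancel₀ hD (e1.trans ?_)
    field_simp
    ring
  · refine mul_left_cancel₀ (pow_ne_zero 2 hD) ?_
    field_simp at e2 ⊢
    linear_combination e2
  · refine mul_left_cancel₀ (pow_ne_zero 3 hD) ?_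
    field_simp at e3 ⊢
    linear_combination e3
  · refine mul_left_cancel₀ (pow_ne_zero 4 hD) ?_
    field_simp at e4 ⊢
    linear_combination e4

/-- The fourth derivative reached with last Schur parameter `rot z₀ x`. -/
noncomputable def w₄ (z₀ w₀ lam mu tau x : ℂ) : ℂ :=
  c₄ z₀ w₀ lam mu tau + (ρ₄ z₀ w₀ lam mu tau : ℂ) * ((‖z₀‖ : ℂ) * x / z₀)

theorem w₁_eq {z₀ : ℂ} (h0 : z₀ ≠ 0) (hz₀ : ‖z₀‖ < 1) (w₀ x : ℂ) :
    w₁ z₀ w₀ x = w₀ / z₀ + (conj z₀ * z₀ - conj w₀ * w₀) / (z₀ * (1 - conj z₀ * z₀)) * x := by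
  have hr : (‖z₀‖ : ℂ) ≠ 0 := by simpa using h0
  have hD : 1 - conj z₀ * z₀ ≠ 0 := one_sub_conj_mul_ne_zero hz₀ hz₀.le
  simp only [w₁, c₁, ρ₁]
  push_cast
  simp only [← Complex.conj_mul']
  generalize 1 - conj z₀ * z₀ = D at *
  field_simp

theorem w₂_eq {z₀ : ℂ} (h0 : z₀ ≠ 0) (hz₀ : ‖z₀‖ < 1) (w₀ lam x : ℂ) :
    w₂ z₀ w₀ lam x = 2 * (conj z₀ * z₀ - conj w₀ * w₀) / (z₀ ^ 2 * (1 - conj z₀ * z₀) ^ 2) *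
      (lam * (1 - conj w₀ * lam) + z₀ * (1 - conj lam * lam) * x) := by
  have hr : (‖z₀‖ : ℂ) ≠ 0 := by simpa using h0
  have hD : 1 - conj z₀ * z₀ ≠ 0 := one_sub_conj_mul_ne_zero hz₀ hz₀.le
  simp only [w₂, c₂, ρ₂]
  push_cast
  simp only [← Complex.conj_mul']
  generalize 1 - conj z₀ * z₀ = D at *
  field_simp

theorem w₃_eq {z₀ : ℂ} (h0 : z₀ ≠ 0) (hz₀ : ‖z₀‖ < 1) (w₀ lam mu x : ℂ) :
    w₃ z₀ w₀ lam mu x = 6 * (conj z₀ * z₀ - conj w₀ * w₀) / (z₀ ^ 3 * (1 - conj z₀ * z₀) ^ 3) *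
      (conj w₀ ^ 2 * lam ^ 3 - conj w₀ * (1 + conj z₀ * z₀) * lam ^ 2 + conj z₀ * z₀ * lam +
        z₀ * mu * (1 - conj lam * lam) *
          (1 + conj z₀ * z₀ - 2 * conj w₀ * lam - z₀ * conj lam * mu) +
        z₀ ^ 2 * (1 - conj lam * lam) * (1 - conj mu * mu) * x) := by
  have hr : (‖z₀‖ : ℂ) ≠ 0 := by simpa using h0
  have hD : 1 - conj z₀ * z₀ ≠ 0 := one_sub_conj_mul_ne_zero hz₀ hz₀.le
  simp only [w₃, c₃, ρ₃, coeffA]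
  push_cast
  simp only [← Complex.conj_mul']
  generalize 1 - conj z₀ * z₀ = D at *
  field_simp

theorem w₄_eq {z₀ : ℂ} (h0 : z₀ ≠ 0) (hz₀ : ‖z₀‖ < 1) (w₀ lam mu tau x : ℂ) :
    w₄ z₀ w₀ lam mu tau x =
      24 * (conj z₀ * z₀ - conj w₀ * w₀) / (z₀ ^ 4 * (1 - conj z₀ * z₀) ^ 4) *
      (coeffB z₀ w₀ lam mu +
        z₀ ^ 2 * tau * (1 - conj lam * lam) * (1 - conj mu * mu) *
          (1 + 2 * (conj z₀ * z₀) - 2 * conj w₀ * lam - 2 * z₀ * conj lam * mu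
            - z₀ * conj mu * tau) +
        z₀ ^ 3 * (1 - conj lam * lam) * (1 - conj mu * mu) * (1 - conj tau * tau) * x) := by
  have hr : (‖z₀‖ : ℂ) ≠ 0 := by simpa using h0
  have hD : 1 - conj z₀ * z₀ ≠ 0 := one_sub_conj_mul_ne_zero hz₀ hz₀.le
  simp only [w₄, c₄, ρ₄]
  push_cast
  simp only [← Complex.conj_mul']
  generalize 1 - conj z₀ * z₀ = D at *
  generalize coeffB z₀ w₀ lam mu = B
  field_simp

section Derivatives

variable {z₀ w₀ lam mu tau x : ℂ} {f g g₁ g₂ g₃ g₄ : ℂ → ℂ}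

/-- In this lemma and the next three the last parameter `x` is free: it can stand for the prescribed
value or for a value still to be determined. -/
theorem deriv_eq_w₁ (h0 : z₀ ≠ 0) (hz₀ : ‖z₀‖ < 1) (hf : ∀ z ∈ ball (0 : ℂ) 1, f z = z * g z)
    (hg : Schur g) (hg₁ : Schur g₁) (s₁ : SchurStep z₀ (w₀ / z₀) g₁ g) (hw : g z₀ = w₀ / z₀)
    (hx : g₁ z₀ = rot z₀ x) : deriv f z₀ = w₁ z₀ w₀ x := by
  rw [(iteratedDeriv_of_schurStep hz₀ h0 hg₁ hg s₁ hw hf).1, w₁_eq h0 hz₀,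
    rotCoeff_zero_of_eq_rot h0 hx]

theorem iteratedDeriv_eq_w₂ (h0 : z₀ ≠ 0) (hz₀ : ‖z₀‖ < 1)
    (hf : ∀ z ∈ ball (0 : ℂ) 1, f z = z * g z)
    (hg : Schur g) (hg₁ : Schur g₁) (s₁ : SchurStep z₀ (w₀ / z₀) g₁ g) (hw : g z₀ = w₀ / z₀)
    (hg₂ : Schur g₂) (s₂ : SchurStep z₀ (rot z₀ lam) g₂ g₁) (hl : g₁ z₀ = rot z₀ lam)
    (hx : g₂ z₀ = rot z₀ x) : iteratedDeriv 2 f z₀ = w₂ z₀ w₀ lam x := by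
  obtain ⟨a1, -⟩ := s₂.rotCoeff_eq hz₀ h0 hg₂ hg₁ hl
  rw [(iteratedDeriv_of_schurStep hz₀ h0 hg₁ hg s₁ hw hf).2.1, w₂_eq h0 hz₀, outer₂, a1,
    rotCoeff_zero_of_eq_rot h0 hl, rotCoeff_zero_of_eq_rot h0 hx]
  congr 1
  ring

theorem iteratedDeriv_eq_w₃ (h0 : z₀ ≠ 0) (hz₀ : ‖z₀‖ < 1)
    (hf : ∀ z ∈ ball (0 : ℂ) 1, f z = z * g z)
    (hg : Schur g) (hg₁ : Schur g₁) (s₁ : SchurStep z₀ (w₀ / z₀) g₁ g) (hw : g z₀ = w₀ / z₀)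
    (hg₂ : Schur g₂) (s₂ : SchurStep z₀ (rot z₀ lam) g₂ g₁) (hl : g₁ z₀ = rot z₀ lam)
    (hg₃ : Schur g₃) (s₃ : SchurStep z₀ (rot z₀ mu) g₃ g₂) (hm : g₂ z₀ = rot z₀ mu)
    (hx : g₃ z₀ = rot z₀ x) : iteratedDeriv 3 f z₀ = w₃ z₀ w₀ lam mu x := by
  obtain ⟨a1, a2, -⟩ := s₂.rotCoeff_eq hz₀ h0 hg₂ hg₁ hl
  obtain ⟨b1, -⟩ := s₃.rotCoeff_eq hz₀ h0 hg₃ hg₂ hm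
  rw [(iteratedDeriv_of_schurStep hz₀ h0 hg₁ hg s₁ hw hf).2.2.1, w₃_eq h0 hz₀, outer₃, outer₂,
    a2, a1, b1, rotCoeff_zero_of_eq_rot h0 hl, rotCoeff_zero_of_eq_rot h0 hm,
    rotCoeff_zero_of_eq_rot h0 hx]
  congr 1
  ring

theorem iteratedDeriv_eq_w₄ (h0 : z₀ ≠ 0) (hz₀ : ‖z₀‖ < 1)
    (hf : ∀ z ∈ ball (0 : ℂ) 1, f z = z * g z)
    (hg : Schur g) (hg₁ : Schur g₁) (s₁ : SchurStep z₀ (w₀ / z₀) g₁ g) (hw : g z₀ = w₀ / z₀)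
    (hg₂ : Schur g₂) (s₂ : SchurStep z₀ (rot z₀ lam) g₂ g₁) (hl : g₁ z₀ = rot z₀ lam)
    (hg₃ : Schur g₃) (s₃ : SchurStep z₀ (rot z₀ mu) g₃ g₂) (hm : g₂ z₀ = rot z₀ mu)
    (hg₄ : Schur g₄) (s₄ : SchurStep z₀ (rot z₀ tau) g₄ g₃) (ht : g₃ z₀ = rot z₀ tau)
    (hx : g₄ z₀ = rot z₀ x) : iteratedDeriv 4 f z₀ = w₄ z₀ w₀ lam mu tau x := by
  obtain ⟨a1, a2, a3⟩ := s₂.rotCoeff_eq hz₀ h0 hg₂ hg₁ hl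
  obtain ⟨b1, b2, -⟩ := s₃.rotCoeff_eq hz₀ h0 hg₃ hg₂ hm
  obtain ⟨c1, -⟩ := s₄.rotCoeff_eq hz₀ h0 hg₄ hg₃ ht
  -- The rewrite by `Complex.conj_mul'` below only recognises squares of the norm, so the sixth
  -- power in `coeffB` is treated separately.
  have h6 : (‖z₀‖ : ℂ) ^ 6 = (conj z₀ * z₀) ^ 3 := by rw [Complex.conj_mul']; ring
  rw [(iteratedDeriv_of_schurStep hz₀ h0 hg₁ hg s₁ hw hf).2.2.2, w₄_eq h0 hz₀, outer₄, outer₃,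
    outer₂, a3, a2, a1, b2, b1, c1, rotCoeff_zero_of_eq_rot h0 hl, rotCoeff_zero_of_eq_rot h0 hm,
    rotCoeff_zero_of_eq_rot h0 ht, rotCoeff_zero_of_eq_rot h0 hx, coeffB, h6]
  simp only [← Complex.conj_mul']
  congr 1
  ring

end Derivatives

/-! ### Schur chains: existence, consequences and the extremal functions -/

theorem Schur.exists_step_or {z₀ : ℂ} (hz₀ : ‖z₀‖ < 1) {g : ℂ → ℂ} (hg : Schur g) :
    (‖g z₀‖ < 1 ∧ ∃ k, Schur k ∧ SchurStep z₀ (g z₀) k g) ∨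
      (‖g z₀‖ = 1 ∧ ∀ k, SchurStep z₀ (g z₀) k g) := by
  have hz₀' : z₀ ∈ ball (0 : ℂ) 1 := by simpa using hz₀
  rcases (hg.2 z₀ hz₀').lt_or_eq with h | h
  · exact .inl ⟨h, hg.exists_step hz₀ h⟩
  · exact .inr ⟨h, schurStep_of_norm_eq_one h (hg.eqOn_of_norm_eq_one hz₀' h)⟩

theorem Schur.exists_step' {z₀ : ℂ} (hz₀ : ‖z₀‖ < 1) {g : ℂ → ℂ} (hg : Schur g) :
    ∃ k, Schur k ∧ SchurStep z₀ (g z₀) k g := by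
  rcases hg.exists_step_or hz₀ with ⟨-, h⟩ | ⟨-, h⟩
  · exact h
  · exact ⟨fun _ => 0, schur_const (by simp), h _⟩

theorem T_neg_self_mul (z₀ a y : ℂ) : T a (T (-z₀) z₀ * y) = a := by
  simp [T]

theorem exists_schur_of_step {z₀ a : ℂ} (hz₀ : ‖z₀‖ < 1) (ha : ‖a‖ ≤ 1) {k : ℂ → ℂ}
    (hk : Schur k) : ∃ g, Schur g ∧ g z₀ = a ∧ SchurStep z₀ a k g := by
  rcases ha.lt_or_eq with h | h
  · obtain ⟨h1, h2⟩ := schurStep_T hz₀ h hk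
    exact ⟨_, h1, T_neg_self_mul _ _ _, h2⟩
  · exact ⟨fun _ => a, schur_const ha, rfl, schurStep_of_norm_eq_one h (fun _ _ => rfl) k⟩

/-- `g, g₁, g₂, g₃, g₄` are the iterates of the Schur algorithm at `z₀` applied to `f z / z`. -/
structure IsSchurChain (z₀ w₀ lam mu tau : ℂ) (f g g₁ g₂ g₃ g₄ : ℂ → ℂ) : Prop where
  eq_mul : ∀ z ∈ ball (0 : ℂ) 1, f z = z * g z
  schur : Schur g
  schur₁ : Schur g₁
  schur₂ : Schur g₂
  schur₃ : Schur g₃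
  schur₄ : Schur g₄
  value : g z₀ = w₀ / z₀
  value₁ : g₁ z₀ = rot z₀ lam
  value₂ : g₂ z₀ = rot z₀ mu
  value₃ : g₃ z₀ = rot z₀ tau
  step₁ : SchurStep z₀ (w₀ / z₀) g₁ g
  step₂ : SchurStep z₀ (rot z₀ lam) g₂ g₁
  step₃ : SchurStep z₀ (rot z₀ mu) g₃ g₂
  step₄ : SchurStep z₀ (rot z₀ tau) g₄ g₃

theorem norm_div_lt_one {z₀ w₀ : ℂ} (hw₀ : ‖w₀‖ < ‖z₀‖) : ‖w₀ / z₀‖ < 1 := by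
  rw [norm_div, div_lt_one ((norm_nonneg _).trans_lt hw₀)]
  exact hw₀

/-- A positive radius lets a prescribed derivative determine its Schur parameter. -/
theorem center_add_injective {z₀ : ℂ} (h0 : z₀ ≠ 0) {ρ : ℝ} (hρ : 0 < ρ) {c x y : ℂ}
    (h : c + (ρ : ℂ) * ((‖z₀‖ : ℂ) * x / z₀) = c + (ρ : ℂ) * ((‖z₀‖ : ℂ) * y / z₀)) : x = y := by
  have hr : (‖z₀‖ : ℂ) ≠ 0 := by simpa using h0
  have hρ' : (ρ : ℂ) ≠ 0 := by exact_mod_cast hρ.ne'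
  have h1 := mul_left_cancel₀ hρ' (add_left_cancel h)
  field_simp at h1
  exact h1

theorem one_sub_norm_sq_pos {a : ℂ} (ha : ‖a‖ < 1) : 0 < 1 - ‖a‖ ^ 2 := by
  nlinarith [norm_nonneg a]

theorem norm_sq_sub_norm_sq_pos {z₀ w₀ : ℂ} (hw₀ : ‖w₀‖ < ‖z₀‖) : 0 < ‖z₀‖ ^ 2 - ‖w₀‖ ^ 2 := by
  nlinarith [norm_nonneg w₀]

section Radii

variable {z₀ w₀ lam mu tau : ℂ} (hz₀ : ‖z₀‖ < 1) (hw₀ : ‖w₀‖ < ‖z₀‖)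
include hz₀ hw₀

theorem ρ₁_pos : 0 < ρ₁ z₀ w₀ := by
  have := one_sub_norm_sq_pos hz₀
  have := norm_sq_sub_norm_sq_pos hw₀
  have := (norm_nonneg w₀).trans_lt hw₀
  unfold ρ₁
  positivity

theorem ρ₂_pos (hl : ‖lam‖ < 1) : 0 < ρ₂ z₀ w₀ lam := by
  have := one_sub_norm_sq_pos hz₀
  have := norm_sq_sub_norm_sq_pos hw₀
  have := (norm_nonneg w₀).trans_lt hw₀
  have := one_sub_norm_sq_pos hl
  unfold ρ₂
  positivity

theorem ρ₃_pos (hl : ‖lam‖ < 1) (hm : ‖mu‖ < 1) : 0 < ρ₃ z₀ w₀ lam mu := by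
  have := one_sub_norm_sq_pos hz₀
  have := norm_sq_sub_norm_sq_pos hw₀
  have := (norm_nonneg w₀).trans_lt hw₀
  have := one_sub_norm_sq_pos hl
  have := one_sub_norm_sq_pos hm
  unfold ρ₃
  positivity

theorem ρ₄_pos (hl : ‖lam‖ < 1) (hm : ‖mu‖ < 1) (ht : ‖tau‖ < 1) :
    0 < ρ₄ z₀ w₀ lam mu tau := by
  have := one_sub_norm_sq_pos hz₀
  have := norm_sq_sub_norm_sq_pos hw₀
  have := (norm_nonneg w₀).trans_lt hw₀
  have := one_sub_norm_sq_pos hl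
  have := one_sub_norm_sq_pos hm
  have := one_sub_norm_sq_pos ht
  unfold ρ₄
  positivity

end Radii

theorem norm_w₄_sub_c₄ {z₀ : ℂ} (h0 : z₀ ≠ 0) {w₀ lam mu tau : ℂ}
    (hρ : 0 < ρ₄ z₀ w₀ lam mu tau) (x : ℂ) :
    ‖w₄ z₀ w₀ lam mu tau x - c₄ z₀ w₀ lam mu tau‖ = ρ₄ z₀ w₀ lam mu tau * ‖x‖ := by
  have hr : ‖z₀‖ ≠ 0 := by simpa using h0
  rw [w₄, add_sub_cancel_left, norm_mul, norm_div, norm_mul, Complex.norm_real, Complex.norm_real,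
    Real.norm_of_nonneg hρ.le, norm_norm, mul_div_cancel_left₀ _ hr]

theorem exists_w₄_eq {z₀ : ℂ} (h0 : z₀ ≠ 0) {w₀ lam mu tau : ℂ}
    (hρ : 0 < ρ₄ z₀ w₀ lam mu tau) (w : ℂ) : ∃ x, w₄ z₀ w₀ lam mu tau x = w := by
  have hr : (‖z₀‖ : ℂ) ≠ 0 := by simpa using h0
  have hρ' : (ρ₄ z₀ w₀ lam mu tau : ℂ) ≠ 0 := by exact_mod_cast hρ.ne'
  refine ⟨(w - c₄ z₀ w₀ lam mu tau) * z₀ / (ρ₄ z₀ w₀ lam mu tau * ‖z₀‖), ?_⟩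
  rw [w₄]
  field_simp
  ring

/-- The parameters are read off one derivative at a time. After a unimodular parameter the remaining
iterates are arbitrary, so they are built backwards from `0` to have the required values at `z₀`. -/
theorem exists_isSchurChain {z₀ w₀ lam mu tau : ℂ} (hz₀ : ‖z₀‖ < 1) (hw₀ : ‖w₀‖ < ‖z₀‖)
    (hmu : ‖mu‖ ≤ 1) (htau : ‖tau‖ ≤ 1) {f : ℂ → ℂ}
    (hf : f ∈ Class z₀ w₀ lam mu tau) :
    ∃ g g₁ g₂ g₃ g₄, IsSchurChain z₀ w₀ lam mu tau f g g₁ g₂ g₃ g₄ := by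
  obtain ⟨⟨hd, hmaps, hf0⟩, v0, v1, v2, v3⟩ := hf
  have h0 : z₀ ≠ 0 := norm_pos_iff.1 ((norm_nonneg _).trans_lt hw₀)
  obtain ⟨hg, hfg⟩ := schur_dslope hd (fun z hz => (mem_ball_zero_iff.1 (hmaps hz)).le) hf0
  have hfg' : ∀ z ∈ ball (0 : ℂ) 1, f z = z * dslope f 0 z := fun z _ => hfg z
  have hw : dslope f 0 z₀ = w₀ / z₀ := by
    rw [eq_div_iff h0, mul_comm, ← hfg, v0]
  generalize dslope f 0 = g at hg hfg' hw
  have hu := norm_div_lt_one hw₀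
  obtain ⟨g₁, hg₁, s₁⟩ := hg.exists_step' hz₀
  rw [hw] at s₁
  have hl : g₁ z₀ = rot z₀ lam := by
    -- The unknown value `g₁ z₀` is written as `rot z₀ x`; comparing two values of the same affine
    -- map then gives `x = lam`.
    have e := deriv_eq_w₁ h0 hz₀ hfg' hg hg₁ s₁ hw (rot_rotCoeff h0 g₁).symm
    rw [v1] at e
    rw [center_add_injective h0 (ρ₁_pos hz₀ hw₀) e, rot_rotCoeff h0]
  have hd₁ := hg₁.exists_step_or hz₀
  rw [hl, norm_rot h0] at hd₁
  rcases hd₁ with ⟨hlt, g₂, hg₂, s₂⟩ | ⟨-, hs₂⟩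
  · have hm : g₂ z₀ = rot z₀ mu := by
      have e := iteratedDeriv_eq_w₂ h0 hz₀ hfg' hg hg₁ s₁ hw hg₂ s₂ hl (rot_rotCoeff h0 g₂).symm
      rw [v2] at e
      rw [center_add_injective h0 (ρ₂_pos hz₀ hw₀ hlt) e, rot_rotCoeff h0]
    have hd₂ := hg₂.exists_step_or hz₀
    rw [hm, norm_rot h0] at hd₂
    rcases hd₂ with ⟨hmt, g₃, hg₃, s₃⟩ | ⟨-, hs₃⟩
    · have ht : g₃ z₀ = rot z₀ tau := by
        have e := iteratedDeriv_eq_w₃ h0 hz₀ hfg' hg hg₁ s₁ hw hg₂ s₂ hl hg₃ s₃ hm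
          (rot_rotCoeff h0 g₃).symm
        rw [v3] at e
        rw [center_add_injective h0 (ρ₃_pos hz₀ hw₀ hlt hmt) e, rot_rotCoeff h0]
      obtain ⟨g₄, hg₄, s₄⟩ := hg₃.exists_step' hz₀
      rw [ht] at s₄
      exact ⟨g, g₁, g₂, g₃, g₄, hfg', hg, hg₁, hg₂, hg₃, hg₄, hw, hl, hm, ht, s₁, s₂, s₃, s₄⟩
    -- Here `g₂` is a unimodular constant, so `hs₃` accepts any `g₃`.
    · obtain ⟨g₃, hg₃, ht, s₄⟩ := exists_schur_of_step (a := rot z₀ tau) hz₀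
        (by rwa [norm_rot h0]) (schur_const (a := 0) (by simp))
      exact ⟨g, g₁, g₂, g₃, _, hfg', hg, hg₁, hg₂, hg₃, schur_const (by simp), hw, hl, hm, ht,
        s₁, s₂, hs₃ g₃, s₄⟩
  · obtain ⟨g₃, hg₃, ht, s₄⟩ := exists_schur_of_step (a := rot z₀ tau) hz₀
      (by rwa [norm_rot h0]) (schur_const (a := 0) (by simp))
    obtain ⟨g₂, hg₂, hm, s₃⟩ := exists_schur_of_step (a := rot z₀ mu) hz₀
      (by rwa [norm_rot h0]) hg₃
    exact ⟨g, g₁, g₂, g₃, _, hfg', hg, hg₁, hg₂, hg₃, schur_const (by simp), hw, hl, hm, ht,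
      s₁, hs₂ g₂, s₃, s₄⟩

namespace IsSchurChain

variable {z₀ w₀ lam mu tau : ℂ} {f g g₁ g₂ g₃ g₄ : ℂ → ℂ}
  (h : IsSchurChain z₀ w₀ lam mu tau f g g₁ g₂ g₃ g₄) (hz₀ : ‖z₀‖ < 1) (hw₀ : ‖w₀‖ < ‖z₀‖)
include h hz₀ hw₀

theorem iteratedDeriv_four :
    iteratedDeriv 4 f z₀ = w₄ z₀ w₀ lam mu tau (rotCoeff z₀ g₄ 0) := by
  have h0 : z₀ ≠ 0 := norm_pos_iff.1 ((norm_nonneg _).trans_lt hw₀)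
  exact iteratedDeriv_eq_w₄ h0 hz₀ h.eq_mul h.schur h.schur₁ h.step₁ h.value h.schur₂ h.step₂
    h.value₁ h.schur₃ h.step₃ h.value₂ h.schur₄ h.step₄ h.value₃ (rot_rotCoeff h0 g₄).symm

/-- When the radius vanishes, the possibly artificial `g₄` has no influence. -/
theorem iteratedDeriv_four_eq_c₄ (hρ : ρ₄ z₀ w₀ lam mu tau = 0) :
    iteratedDeriv 4 f z₀ = c₄ z₀ w₀ lam mu tau := by
  simp [h.iteratedDeriv_four hz₀ hw₀, w₄, hρ]

theorem mem_class : f ∈ Class z₀ w₀ lam mu tau := by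
  have h0 : z₀ ≠ 0 := norm_pos_iff.1 ((norm_nonneg _).trans_lt hw₀)
  refine ⟨⟨?_, ?_, ?_⟩, ?_, ?_, ?_, ?_⟩
  · exact (differentiableOn_id.mul h.schur.1).congr h.eq_mul
  · intro z hz
    have hzn : ‖z‖ < 1 := by simpa using hz
    rw [mem_ball_zero_iff, h.eq_mul z hz, norm_mul]
    exact mul_lt_one_of_nonneg_of_lt_one_left (norm_nonneg _) hzn (h.schur.2 z hz)
  · simpa using h.eq_mul 0 (by simp)
  · rw [h.eq_mul z₀ (by simpa using hz₀), h.value, mul_div_cancel₀ _ h0]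
  · exact deriv_eq_w₁ h0 hz₀ h.eq_mul h.schur h.schur₁ h.step₁ h.value h.value₁
  · exact iteratedDeriv_eq_w₂ h0 hz₀ h.eq_mul h.schur h.schur₁ h.step₁ h.value h.schur₂ h.step₂
      h.value₁ h.value₂
  · exact iteratedDeriv_eq_w₃ h0 hz₀ h.eq_mul h.schur h.schur₁ h.step₁ h.value h.schur₂ h.step₂
      h.value₁ h.schur₃ h.step₃ h.value₂ h.value₃

theorem eq_mul_T {z : ℂ} (hz : z ∈ ball (0 : ℂ) 1) :
    f z = z * T (w₀ / z₀) (T (-z₀) z * g₁ z) := by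
  rw [h.eq_mul z hz, h.step₁.eq_T hz₀ (norm_div_lt_one hw₀) h.schur₁ hz]

theorem eqOn_F₁ (hl : ‖lam‖ = 1) : EqOn f (F₁ z₀ w₀ lam) (ball 0 1) := by
  intro z hz
  have h0 : z₀ ≠ 0 := norm_pos_iff.1 ((norm_nonneg _).trans_lt hw₀)
  rw [h.eq_mul_T hz₀ hw₀ hz, h.schur₁.eqOn_of_norm_eq_one (z₁ := z₀) (by simpa using hz₀)
    (by rwa [h.value₁, norm_rot h0]) z hz, h.value₁, F₁, mul_comm (T (-z₀) z)]

theorem eqOn_F₂ (hl : ‖lam‖ < 1) (hm : ‖mu‖ = 1) : EqOn f (F₂ z₀ w₀ lam mu) (ball 0 1) := by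
  intro z hz
  have h0 : z₀ ≠ 0 := norm_pos_iff.1 ((norm_nonneg _).trans_lt hw₀)
  rw [h.eq_mul_T hz₀ hw₀ hz, h.step₂.eq_T hz₀ (by rwa [norm_rot h0]) h.schur₂ hz,
    h.schur₂.eqOn_of_norm_eq_one (z₁ := z₀) (by simpa using hz₀)
    (by rwa [h.value₂, norm_rot h0]) z hz, h.value₂, F₂, mul_comm _ (rot z₀ mu)]

theorem eqOn_F₃ (hl : ‖lam‖ < 1) (hm : ‖mu‖ < 1) (ht : ‖tau‖ = 1) :
    EqOn f (F₃ z₀ w₀ lam mu tau) (ball 0 1) := by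
  intro z hz
  have h0 : z₀ ≠ 0 := norm_pos_iff.1 ((norm_nonneg _).trans_lt hw₀)
  rw [h.eq_mul_T hz₀ hw₀ hz, h.step₂.eq_T hz₀ (by rwa [norm_rot h0]) h.schur₂ hz,
    h.step₃.eq_T hz₀ (by rwa [norm_rot h0]) h.schur₃ hz,
    h.schur₃.eqOn_of_norm_eq_one (z₁ := z₀) (by simpa using hz₀)
    (by rwa [h.value₃, norm_rot h0]) z hz, h.value₃, F₃, mul_comm _ (rot z₀ tau)]

theorem eqOn_F₄ (hl : ‖lam‖ < 1) (hm : ‖mu‖ < 1) (ht : ‖tau‖ < 1) (hg : ‖g₄ z₀‖ = 1) :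
    EqOn f (F₄ z₀ w₀ lam mu tau (g₄ z₀)) (ball 0 1) := by
  intro z hz
  have h0 : z₀ ≠ 0 := norm_pos_iff.1 ((norm_nonneg _).trans_lt hw₀)
  rw [h.eq_mul_T hz₀ hw₀ hz, h.step₂.eq_T hz₀ (by rwa [norm_rot h0]) h.schur₂ hz,
    h.step₃.eq_T hz₀ (by rwa [norm_rot h0]) h.schur₃ hz,
    h.step₄.eq_T hz₀ (by rwa [norm_rot h0]) h.schur₄ hz,
    h.schur₄.eqOn_of_norm_eq_one (z₁ := z₀) (by simpa using hz₀) hg z hz, F₄,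
    mul_comm _ (g₄ z₀)]

end IsSchurChain

/-- The algorithm run in reverse, starting from the constant `α`. -/
theorem isSchurChain_F₄ {z₀ w₀ lam mu tau α : ℂ} (hz₀ : ‖z₀‖ < 1) (hw₀ : ‖w₀‖ < ‖z₀‖)
    (hl : ‖lam‖ < 1) (hm : ‖mu‖ < 1) (ht : ‖tau‖ < 1) (hα : ‖α‖ ≤ 1) :
    ∃ g g₁ g₂ g₃, IsSchurChain z₀ w₀ lam mu tau (F₄ z₀ w₀ lam mu tau α) g g₁ g₂ g₃
      fun _ => α := by
  have h0 : z₀ ≠ 0 := norm_pos_iff.1 ((norm_nonneg _).trans_lt hw₀)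
  have hs₄ := schur_const hα
  obtain ⟨hs₃, t₄⟩ := schurStep_T (a := rot z₀ tau) hz₀ (by rwa [norm_rot h0]) hs₄
  obtain ⟨hs₂, t₃⟩ := schurStep_T (a := rot z₀ mu) hz₀ (by rwa [norm_rot h0]) hs₃
  obtain ⟨hs₁, t₂⟩ := schurStep_T (a := rot z₀ lam) hz₀ (by rwa [norm_rot h0]) hs₂
  obtain ⟨hs, t₁⟩ := schurStep_T hz₀ (norm_div_lt_one hw₀) hs₁
  refine ⟨_, _, _, _, fun z _ => ?_, hs, hs₁, hs₂, hs₃, hs₄, T_neg_self_mul _ _ _,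
    T_neg_self_mul _ _ _, T_neg_self_mul _ _ _, T_neg_self_mul _ _ _, t₁, t₂, t₃, t₄⟩
  rw [F₄, mul_comm α]

end Dieudonne

/-! ### The theorem -/

theorem theorem1 (z₀ w₀ lam mu tau : ℂ) (hz₀ : ‖z₀‖ < 1) (hw₀ : ‖w₀‖ < ‖z₀‖)
    (hlam : ‖lam‖ ≤ 1) (hmu : ‖mu‖ ≤ 1) (htau : ‖tau‖ ≤ 1) :
    (‖lam‖ = 1 → ∀ f ∈ Dieudonne.Class z₀ w₀ lam mu tau,
      iteratedDeriv 4 f z₀ = Dieudonne.c₄ z₀ w₀ lam mu tau ∧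
      EqOn f (Dieudonne.F₁ z₀ w₀ lam) (ball 0 1)) ∧
    (‖lam‖ < 1 → ‖mu‖ = 1 → ∀ f ∈ Dieudonne.Class z₀ w₀ lam mu tau,
      iteratedDeriv 4 f z₀ = Dieudonne.c₄ z₀ w₀ lam mu tau ∧
      EqOn f (Dieudonne.F₂ z₀ w₀ lam mu) (ball 0 1)) ∧
    (‖lam‖ < 1 → ‖mu‖ < 1 → ‖tau‖ = 1 → ∀ f ∈ Dieudonne.Class z₀ w₀ lam mu tau,
      iteratedDeriv 4 f z₀ = Dieudonne.c₄ z₀ w₀ lam mu tau ∧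
      EqOn f (Dieudonne.F₃ z₀ w₀ lam mu tau) (ball 0 1)) ∧
    (‖lam‖ < 1 → ‖mu‖ < 1 → ‖tau‖ < 1 →
      {w : ℂ | ∃ f ∈ Dieudonne.Class z₀ w₀ lam mu tau, iteratedDeriv 4 f z₀ = w} =
        closedBall (Dieudonne.c₄ z₀ w₀ lam mu tau) (Dieudonne.ρ₄ z₀ w₀ lam mu tau) ∧
      (∀ α ∈ closedBall (0 : ℂ) 1,
        Dieudonne.F₄ z₀ w₀ lam mu tau α ∈ Dieudonne.Class z₀ w₀ lam mu tau) ∧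
      closedBall (Dieudonne.c₄ z₀ w₀ lam mu tau) (Dieudonne.ρ₄ z₀ w₀ lam mu tau) =
        {w : ℂ | ∃ α ∈ closedBall (0 : ℂ) 1,
          iteratedDeriv 4 (Dieudonne.F₄ z₀ w₀ lam mu tau α) z₀ = w} ∧
      ∀ f ∈ Dieudonne.Class z₀ w₀ lam mu tau,
        (iteratedDeriv 4 f z₀ ∈
            sphere (Dieudonne.c₄ z₀ w₀ lam mu tau) (Dieudonne.ρ₄ z₀ w₀ lam mu tau) ↔
          ∃ θ : ℝ, EqOn f
            (Dieudonne.F₄ z₀ w₀ lam mu tau (Complex.exp (Complex.I * θ))) (ball 0 1))) := by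
  have h0 : z₀ ≠ 0 := norm_pos_iff.1 ((norm_nonneg _).trans_lt hw₀)
  have key := fun f (hf : f ∈ Dieudonne.Class z₀ w₀ lam mu tau) =>
    Dieudonne.exists_isSchurChain hz₀ hw₀ hmu htau hf
  refine ⟨fun hl f hf => ?_, fun hl hm f hf => ?_, fun hl hm ht f hf => ?_, fun hl hm ht => ?_⟩
  · obtain ⟨g, g₁, g₂, g₃, g₄, h⟩ := key f hf
    exact ⟨h.iteratedDeriv_four_eq_c₄ hz₀ hw₀ (by simp [Dieudonne.ρ₄, hl]), h.eqOn_F₁ hz₀ hw₀ hl⟩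
  · obtain ⟨g, g₁, g₂, g₃, g₄, h⟩ := key f hf
    exact ⟨h.iteratedDeriv_four_eq_c₄ hz₀ hw₀ (by simp [Dieudonne.ρ₄, hm]),
      h.eqOn_F₂ hz₀ hw₀ hl hm⟩
  · obtain ⟨g, g₁, g₂, g₃, g₄, h⟩ := key f hf
    exact ⟨h.iteratedDeriv_four_eq_c₄ hz₀ hw₀ (by simp [Dieudonne.ρ₄, ht]),
      h.eqOn_F₃ hz₀ hw₀ hl hm ht⟩
  have hρ := Dieudonne.ρ₄_pos hz₀ hw₀ hl hm ht
  have hF : ∀ α : ℂ, ‖α‖ ≤ 1 →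
      Dieudonne.F₄ z₀ w₀ lam mu tau α ∈ Dieudonne.Class z₀ w₀ lam mu tau := by
    intro α hα
    obtain ⟨g, g₁, g₂, g₃, h⟩ := Dieudonne.isSchurChain_F₄ hz₀ hw₀ hl hm ht hα
    exact h.mem_class hz₀ hw₀
  have hF' : ∀ x : ℂ, ‖x‖ ≤ 1 → iteratedDeriv 4
      (Dieudonne.F₄ z₀ w₀ lam mu tau (Dieudonne.rot z₀ x)) z₀ =
        Dieudonne.w₄ z₀ w₀ lam mu tau x := by
    intro x hx
    obtain ⟨g, g₁, g₂, g₃, h⟩ := Dieudonne.isSchurChain_F₄ (α := Dieudonne.rot z₀ x) hz₀ hw₀ hl hm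
      ht (by rwa [Dieudonne.norm_rot h0])
    rw [h.iteratedDeriv_four hz₀ hw₀,
      Dieudonne.rotCoeff_zero_of_eq_rot (f := fun _ => Dieudonne.rot z₀ x) h0 rfl]
  have hsub : ∀ f ∈ Dieudonne.Class z₀ w₀ lam mu tau, iteratedDeriv 4 f z₀ ∈
      closedBall (Dieudonne.c₄ z₀ w₀ lam mu tau) (Dieudonne.ρ₄ z₀ w₀ lam mu tau) := by
    intro f hf
    obtain ⟨g, g₁, g₂, g₃, g₄, h⟩ := key f hf
    -- Since `rot z₀` preserves norms, the distance to the center is `ρ₄` times `‖g₄ z₀‖`.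
    rw [mem_closedBall, dist_eq_norm, h.iteratedDeriv_four hz₀ hw₀,
      Dieudonne.norm_w₄_sub_c₄ h0 hρ, ← Dieudonne.norm_rot h0, Dieudonne.rot_rotCoeff h0]
    exact mul_le_of_le_one_right hρ.le (h.schur₄.2 z₀ (by simpa using hz₀))
  have hsurj : ∀ w ∈ closedBall (Dieudonne.c₄ z₀ w₀ lam mu tau) (Dieudonne.ρ₄ z₀ w₀ lam mu tau),
      ∃ α ∈ closedBall (0 : ℂ) 1,
        iteratedDeriv 4 (Dieudonne.F₄ z₀ w₀ lam mu tau α) z₀ = w := by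
    intro w hw
    obtain ⟨x, rfl⟩ := Dieudonne.exists_w₄_eq h0 hρ w
    rw [mem_closedBall, dist_eq_norm, Dieudonne.norm_w₄_sub_c₄ h0 hρ,
      mul_le_iff_le_one_right hρ] at hw
    exact ⟨Dieudonne.rot z₀ x, by simpa [Dieudonne.norm_rot h0] using hw, hF' x hw⟩
  refine ⟨?_, fun α hα => hF α (by simpa using hα), ?_, ?_⟩
  · refine Subset.antisymm ?_ fun w hw => ?_
    · rintro w ⟨f, hf, rfl⟩
      exact hsub f hf
    · obtain ⟨α, hα, rfl⟩ := hsurj w hw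
      exact ⟨_, hF α (by simpa using hα), rfl⟩
  · refine Subset.antisymm hsurj ?_
    rintro w ⟨α, hα, rfl⟩
    exact hsub _ (hF α (by simpa using hα))
  · intro f hf
    constructor
    · intro hs
      obtain ⟨g, g₁, g₂, g₃, g₄, h⟩ := key f hf
      rw [mem_sphere, dist_eq_norm, h.iteratedDeriv_four hz₀ hw₀,
        Dieudonne.norm_w₄_sub_c₄ h0 hρ, ← Dieudonne.norm_rot h0, Dieudonne.rot_rotCoeff h0,
        mul_eq_left₀ hρ.ne'] at hs
      obtain ⟨θ, hθ⟩ := (Complex.norm_eq_one_iff _).1 hs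
      refine ⟨θ, ?_⟩
      rw [mul_comm, hθ]
      exact h.eqOn_F₄ hz₀ hw₀ hl hm ht hs
    · rintro ⟨θ, hθ⟩
      have hn : ‖Complex.exp (Complex.I * θ)‖ = 1 := by
        rw [mul_comm, Complex.norm_exp_ofReal_mul_I]
      obtain ⟨g, g₁, g₂, g₃, h⟩ := Dieudonne.isSchurChain_F₄ hz₀ hw₀ hl hm ht hn.le
      -- Agreement on the disk suffices: the derivatives at `z₀` depend only on the germ.
      have e : f =ᶠ[nhds z₀] Dieudonne.F₄ z₀ w₀ lam mu tau (Complex.exp (Complex.I * θ)) :=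
        hθ.eventuallyEq_of_mem (isOpen_ball.mem_nhds (by simpa using hz₀))
      rw [e.iteratedDeriv_eq 4, mem_sphere, dist_eq_norm, h.iteratedDeriv_four hz₀ hw₀,
        Dieudonne.norm_w₄_sub_c₄ h0 hρ, ← Dieudonne.norm_rot h0, Dieudonne.rot_rotCoeff h0, hn,
        mul_one]
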